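/- Let $(M,g)$ be a complete, connected, smooth Riemannian manifold without boundary, with Riemannian measure $dM$ (given by $\sqrt{\det g_{ij}}\,dy$ in charts). Let $x_0,x_1$ be random points of $M$ on a probability space, and let $x_t=I(t;x_0,x_1)$, $t\in[0,1]$, be a stochastic interpolant between them: $I(t;\cdot,\cdot):M\times M\to M$ is measurable for each $t\in[0,1]$, and almost surely $t\mapsto I(t;x_0,x_1)$ is a $C^1$ curve on $[0,1]$ (one-sided derivatives at the ends) with $I(0;x_0,x_1)=x_0$ and $I(1;x_0,x_1)=x_1$. Assume that for every compact $K\subset M$ the random variables $|\partial_t x_t|\,\mathbf 1_{\{x_t\in K\}}$, $t\in[0,1]$, are uniformly integrable (for instance, $|\partial_t x_t|\le Z$ for all $t$ with $\mathbb E Z<\infty$). Assume that for every $t\in[0,1]$ the law of $x_t$ has a density $\rho(t,\cdot)\ge 0$ with respect to $dM$, and that $\rho\in C^1([0,1];C^2(M))$, where $C^2(M)$ carries the topology of locally uniform convergence of the derivatives of order at most two in charts. Let $v(t,x)=\mathbb E[\partial_t x_t\mid x_t=x]\in T_xM$ be the velocity field, i.e. $v(t,\cdot)$ is a Borel vector field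 with $\alpha(v(t,x_t))=\mathbb E[\alpha(\partial_t x_t)\mid x_t]$ almost surely for every smooth compactly supported one-form $\alpha$. Assume that $$\int_M |v(t,x)|\,\rho(t,x)\,dM(x)<\infty\qquad\text{for every }t\in[0,1].$$ Then $\rho$ solves the transport equation $$\partial_t\rho+\operatorname{div}(\rho v)=0\qquad\text{on }[0,1]\times M,$$ where the divergence is defined through Stokes' formula: for every $t\in[0,1]$ the vector field $\rho(t,\cdot)v(t,\cdot)$ has the divergence $-\partial_t\rho(t,\cdot)$, in the sense that for all $\varphi\in C_c^\infty(M)$ the following integrals converge and $$\int_M \varphi\,\partial_t\rho(t,x)\,dM(x)=\int_M d\varphi\big(v(t,x)\big)\,\rho(t,x)\,dM(x).$$ -/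

import Mathlib

open Set Filter MeasureTheory Manifold Bundle
open scoped Topology ContDiff

noncomputable section

namespace RiemannianInterpolant

variable {d : ℕ}
  {M : Type*} [TopologicalSpace M] [ChartedSpace (EuclideanSpace ℝ (Fin d)) M]

/-! ### The Riemannian measure -/

/-- The coordinate vector `∂ᵢ` of the chart around `p`, at the point with coordinates `y`. -/
def coordVector (p : M) (y : EuclideanSpace ℝ (Fin d)) (i : Fin d) :
    TangentSpace (𝓡 d) ((chartAt (EuclideanSpace ℝ (Fin d)) p).symm y) :=
  mfderiv (𝓡 d) (𝓡 d) (chartAt (EuclideanSpace ℝ (Fin d)) p).symm y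
    (EuclideanSpace.single i (1 : ℝ))

/-- The Gram matrix `G = (g(∂ᵢ, ∂ⱼ))` of the metric in the chart around `p`. -/
def gram [RiemannianBundle (fun x : M ↦ TangentSpace (𝓡 d) x)]
    (p : M) (y : EuclideanSpace ℝ (Fin d)) : Matrix (Fin d) (Fin d) ℝ :=
  Matrix.of fun i j ↦ inner ℝ (coordVector p y i) (coordVector p y j)

/-- The Riemannian measure of the domain of the chart around `p`:
`√(det G) dy`, transported to the manifold. -/
def chartMeasure [RiemannianBundle (fun x : M ↦ TangentSpace (𝓡 d) x)] [MeasurableSpace M]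
    (p : M) : Measure M :=
  (((volume : Measure (EuclideanSpace ℝ (Fin d))).restrict
      (chartAt (EuclideanSpace ℝ (Fin d)) p).target).withDensity
      fun y ↦ ENNReal.ofReal (Real.sqrt (gram p y).det)).map
    (chartAt (EuclideanSpace ℝ (Fin d)) p).symm

variable (d M) in
/-- The Riemannian measure: the least measure that dominates the measures `√(det G) dy` of all
chart domains. As these agree on the overlaps of the charts, this is the measure obtained by
gluing them, i.e. its restriction to each chart domain is `√(det G) dy`. -/
def riemannianMeasure [RiemannianBundle (fun x : M ↦ TangentSpace (𝓡 d) x)] [MeasurableSpace M] :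
    Measure M :=
  ⨆ p : M, chartMeasure (d := d) p

/-! ### Time-dependent functions of class `C¹([0,1]; C²(M))` -/

/-- Convergence in the space `C²(M)`: in every chart, locally uniform convergence of all
derivatives of order at most two. -/
def TendstoC2 (d : ℕ) {M : Type*} [TopologicalSpace M]
    [ChartedSpace (EuclideanSpace ℝ (Fin d)) M] {ι : Type*}
    (F : ι → M → ℝ) (l : Filter ι) (f : M → ℝ) : Prop :=
  ∀ p : M, ∀ k : ℕ, k ≤ 2 →
    TendstoLocallyUniformlyOn
      (fun i ↦ iteratedFDeriv ℝ k (F i ∘ (chartAt (EuclideanSpace ℝ (Fin d)) p).symm))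
      (iteratedFDeriv ℝ k (f ∘ (chartAt (EuclideanSpace ℝ (Fin d)) p).symm))
      l (chartAt (EuclideanSpace ℝ (Fin d)) p).target

/-- `∂ₜρ(t, x)`, one-sided at the ends of `[0,1]`. -/
def timeDeriv {M : Type*} (ρ : ℝ → M → ℝ) (t : ℝ) (x : M) : ℝ :=
  derivWithin (fun s ↦ ρ s x) (Icc 0 1) t

/-- `ρ ∈ C¹([0,1]; C²(M))`. -/
structure IsC1C2 (d : ℕ) {M : Type*} [TopologicalSpace M]
    [ChartedSpace (EuclideanSpace ℝ (Fin d)) M] (ρ : ℝ → M → ℝ) : Prop where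
  contMDiff : ∀ t ∈ Icc (0 : ℝ) 1, ContMDiff (𝓡 d) 𝓘(ℝ) 2 (ρ t)
  contMDiff_timeDeriv : ∀ t ∈ Icc (0 : ℝ) 1, ContMDiff (𝓡 d) 𝓘(ℝ) 2 (timeDeriv ρ t)
  tendsto_slope : ∀ t ∈ Icc (0 : ℝ) 1,
    TendstoC2 d (fun s x ↦ (s - t)⁻¹ * (ρ s x - ρ t x)) (𝓝[Icc 0 1 \ {t}] t) (timeDeriv ρ t)
  tendsto_timeDeriv : ∀ t ∈ Icc (0 : ℝ) 1,
    TendstoC2 d (timeDeriv ρ) (𝓝[Icc 0 1] t) (timeDeriv ρ t)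

/-! ### Stochastic interpolants and their velocity fields -/

/-- `x_t = I(t; x₀, x₁)` is a stochastic interpolant between the random points `x₀` and `x₁`:
almost surely, `t ↦ I(t; x₀, x₁)` is a continuously differentiable curve in `M`, defined for
`t ∈ [0,1]`, that starts at `x₀` and ends at `x₁`. -/
structure IsStochasticInterpolant [MeasurableSpace M] {Ω : Type*} [MeasurableSpace Ω]
    (P : Measure Ω) (I : ℝ → M → M → M) (x₀ x₁ : Ω → M) : Prop where
  measurable_left : Measurable x₀
  measurable_right : Measurable x₁
  measurable : ∀ t ∈ Icc (0 : ℝ) 1, Measurable fun z : M × M ↦ I t z.1 z.2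
  left : ∀ᵐ w ∂P, I 0 (x₀ w) (x₁ w) = x₀ w
  right : ∀ᵐ w ∂P, I 1 (x₀ w) (x₁ w) = x₁ w
  contMDiffOn : ∀ᵐ w ∂P,
    ContMDiffOn 𝓘(ℝ) (𝓡 d) 1 (fun t ↦ I t (x₀ w) (x₁ w)) (Icc 0 1)

/-- The time derivative `∂ₜ xₜ` of a process on `M`, a tangent vector at `xₜ`
(one-sided at the ends of `[0,1]`). -/
def pathDeriv {Ω : Type*} (x : ℝ → Ω → M) (t : ℝ) (w : Ω) : TangentSpace (𝓡 d) (x t w) :=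
  mfderivWithin 𝓘(ℝ) (𝓡 d) (fun s ↦ x s w) (Icc 0 1) t (1 : ℝ)

/-- A smooth one-form with compact support. -/
structure IsTestForm [IsManifold (𝓡 d) 1 M] (α : ∀ x : M, TangentSpace (𝓡 d) x →L[ℝ] ℝ) :
    Prop where
  contMDiff : ContMDiff (𝓡 d) ((𝓡 d).prod 𝓘(ℝ, EuclideanSpace ℝ (Fin d) →L[ℝ] ℝ)) ∞
    fun x ↦ TotalSpace.mk' (EuclideanSpace ℝ (Fin d) →L[ℝ] ℝ) x (α x)
  compactSupport : ∃ K : Set M, IsCompact K ∧ ∀ x ∉ K, α x = 0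

/-- `v` is (a version of) the velocity field `v(t, x) = E[∂ₜ xₜ | xₜ = x]`: a Borel vector field
such that `E[α(∂ₜ xₜ) | xₜ] = α(v(t, xₜ))` almost surely, whatever the linear functional `α` on
the tangent spaces (depending smoothly on the point, and with compact support). -/
structure IsVelocityField [IsManifold (𝓡 d) 1 M] [mM : MeasurableSpace M]
    {Ω : Type*} [MeasurableSpace Ω] (P : Measure Ω) (x : ℝ → Ω → M)
    (v : ℝ → ∀ y : M, TangentSpace (𝓡 d) y) : Prop where
  measurable : ∀ t ∈ Icc (0 : ℝ) 1,
    Measurable[mM, borel (TangentBundle (𝓡 d) M)] fun y ↦ (⟨y, v t y⟩ : TangentBundle (𝓡 d) M)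
  condExp : ∀ t ∈ Icc (0 : ℝ) 1, ∀ α : (∀ y : M, TangentSpace (𝓡 d) y →L[ℝ] ℝ), IsTestForm α →
    P[fun w ↦ α (x t w) (pathDeriv x t w) | mM.comap (x t)]
      =ᵐ[P] fun w ↦ α (x t w) (v t (x t w))

/-! ### Divergence -/

/-- The function `h` is the divergence of the vector field `X` with respect to the measure `m`,
in the sense of Stokes' formula: `∫ h φ dm = - ∫ dφ(X) dm` for all smooth `φ` with compact
support (and these integrals converge). -/
def HasDivergence [MeasurableSpace M] (m : Measure M) (X : ∀ x : M, TangentSpace (𝓡 d) x)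
    (h : M → ℝ) : Prop :=
  ∀ φ : M → ℝ, ContMDiff (𝓡 d) 𝓘(ℝ) ∞ φ → HasCompactSupport φ →
    Integrable (fun x ↦ h x * φ x) m ∧
    Integrable (fun x ↦ (mfderiv (𝓡 d) 𝓘(ℝ) φ x (X x) : ℝ)) m ∧
    ∫ x, h x * φ x ∂m = - ∫ x, (mfderiv (𝓡 d) 𝓘(ℝ) φ x (X x) : ℝ) ∂m

end RiemannianInterpolant

end

noncomputable section

namespace RiemannianInterpolant

variable {d : ℕ}
  {M : Type*} [TopologicalSpace M] [ChartedSpace (EuclideanSpace ℝ (Fin d)) M]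

/-! For a test function `φ`, the number `E φ(x_t)` equals `∫ ρ φ dM`, and its time derivative is
computed in two ways. Since `ρ` is `C¹` in time, locally uniformly in space, the derivative is `∫
∂ₜρ φ dM`. By the chain rule along paths it is also `E dφ(∂ₜx_t)`; conditioning on `x_t` turns this
into `E dφ(v(t, x_t)) = ∫ ρ dφ(v) dM`. Equating the two says that `-∂ₜρ` is the divergence of `ρv`.

Two points need work. Differentiating under the expectation has only uniform integrability
available, not a dominating variable: `hasDerivWithinAt_integral_of_uniformIntegrable` integrates
the paths in time, applies Fubini, and uses Vitali's theorem to see that the resulting integrand is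
continuous. Differentiating under `∫ dM` needs compact sets to have finite Riemannian measure. As
the measure is a supremum over all charts, `riemannianMeasure_lt_top_of_isCompact` rests on the
invariance of `√(det G) dy` under changes of chart. -/

/-! ### Change of charts and the Riemannian measure -/

/-- The inner product of the tangent space at `z`, as a bilinear form on the model space. -/
def modelInner [RiemannianBundle (fun x : M ↦ TangentSpace (𝓡 d) x)] (z : M) :
    EuclideanSpace ℝ (Fin d) →ₗ[ℝ] EuclideanSpace ℝ (Fin d) →ₗ[ℝ] ℝ :=
  LinearMap.mk₂ ℝ
    (fun u w ↦ inner ℝ (show TangentSpace (𝓡 d) z from u) (show TangentSpace (𝓡 d) z from w))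
    (fun u u' w ↦ inner_add_left (E := TangentSpace (𝓡 d) z) u u' w)
    (fun c u w ↦ real_inner_smul_left (F := TangentSpace (𝓡 d) z) u w c)
    (fun u w w' ↦ inner_add_right (E := TangentSpace (𝓡 d) z) u w w')
    (fun c u w ↦ real_inner_smul_right (F := TangentSpace (𝓡 d) z) u w c)

/-- The coordinate vector `∂ᵢ` of the chart around `p`, as an element of the model space. -/
def modelCoordVector (p : M) (y : EuclideanSpace ℝ (Fin d)) (i : Fin d) :
    EuclideanSpace ℝ (Fin d) :=
  coordVector p y i

theorem gram_apply [RiemannianBundle (fun x : M ↦ TangentSpace (𝓡 d) x)] (p : M)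
    (y : EuclideanSpace ℝ (Fin d)) (i j : Fin d) :
    gram p y i j = modelInner ((chartAt (EuclideanSpace ℝ (Fin d)) p).symm y)
      (modelCoordVector p y i) (modelCoordVector p y j) :=
  rfl

/-- The change of coordinates from the chart around `q` to the chart around `p`. -/
def transition (p q : M) (y : EuclideanSpace ℝ (Fin d)) : EuclideanSpace ℝ (Fin d) :=
  chartAt (EuclideanSpace ℝ (Fin d)) p ((chartAt (EuclideanSpace ℝ (Fin d)) q).symm y)

theorem mdifferentiableAt_transition [IsManifold (𝓡 d) 1 M] {p q : M}
    {y : EuclideanSpace ℝ (Fin d)} (hy : y ∈ (chartAt (EuclideanSpace ℝ (Fin d)) q).target)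
    (hp : (chartAt (EuclideanSpace ℝ (Fin d)) q).symm y ∈
      (chartAt (EuclideanSpace ℝ (Fin d)) p).source) :
    MDifferentiableAt (𝓡 d) (𝓡 d) (transition p q) y :=
  (mdifferentiableAt_atlas (chart_mem_atlas _ p) hp).comp y
    (mdifferentiableAt_atlas_symm (chart_mem_atlas _ q) hy)

theorem modelCoordVector_eq_sum [IsManifold (𝓡 d) 1 M] {p q : M}
    {y : EuclideanSpace ℝ (Fin d)} (hy : y ∈ (chartAt (EuclideanSpace ℝ (Fin d)) q).target)
    (hp : (chartAt (EuclideanSpace ℝ (Fin d)) q).symm y ∈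
      (chartAt (EuclideanSpace ℝ (Fin d)) p).source) (i : Fin d) :
    modelCoordVector q y i =
      ∑ k, (fderiv ℝ (transition p q) y (EuclideanSpace.single i 1)) k •
        modelCoordVector p (transition p q y) k := by
  set e := chartAt (EuclideanSpace ℝ (Fin d)) p
  set f := chartAt (EuclideanSpace ℝ (Fin d)) q
  have hev : f.symm =ᶠ[𝓝 y] e.symm ∘ transition p q := by
    have : ∀ᶠ z in 𝓝 y, f.symm z ∈ e.source :=
      (f.continuousAt_symm hy).preimage_mem_nhds (e.open_source.mem_nhds hp)
    filter_upwards [this] with z hz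
    exact (e.left_inv hz).symm
  have hT : transition p q y ∈ e.target := e.map_source hp
  have h1 : mfderiv (𝓡 d) (𝓡 d) f.symm y =
      (mfderiv (𝓡 d) (𝓡 d) e.symm (transition p q y)).comp
        (mfderiv (𝓡 d) (𝓡 d) (transition p q) y) := by
    rw [hev.mfderiv_eq]
    exact mfderiv_comp y (mdifferentiableAt_atlas_symm (chart_mem_atlas _ p) hT)
      (mdifferentiableAt_transition hy hp)
  obtain ⟨D, hD⟩ : ∃ D : EuclideanSpace ℝ (Fin d) →L[ℝ] EuclideanSpace ℝ (Fin d),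
      D = mfderiv (𝓡 d) (𝓡 d) e.symm (transition p q y) := ⟨_, rfl⟩
  have hc : ∀ k, modelCoordVector p (transition p q y) k = D (EuclideanSpace.single k 1) := by
    intro k; rw [hD]; rfl
  have h2 : modelCoordVector q y i =
      D (fderiv ℝ (transition p q) y (EuclideanSpace.single i 1)) := by
    rw [← mfderiv_eq_fderiv, hD]
    exact DFunLike.congr_fun h1 (EuclideanSpace.single i (1 : ℝ))
  rw [h2]
  set w := fderiv ℝ (transition p q) y (EuclideanSpace.single i 1)
  have hw : w = ∑ k, w k • EuclideanSpace.single k (1 : ℝ) := by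
    ext j; simp [Finset.sum_apply, Pi.single_apply]
  conv_lhs => rw [hw]
  simp only [map_sum, map_smul, hc]

/-- With `J` the Jacobian matrix of the transition map, the Gram matrices are related by `JᵀGJ`, so
the determinant picks up the factor `(det J)²`. -/
theorem sqrt_det_gram [IsManifold (𝓡 d) 1 M]
    [RiemannianBundle (fun x : M ↦ TangentSpace (𝓡 d) x)] {p q : M}
    {y : EuclideanSpace ℝ (Fin d)} (hy : y ∈ (chartAt (EuclideanSpace ℝ (Fin d)) q).target)
    (hp : (chartAt (EuclideanSpace ℝ (Fin d)) q).symm y ∈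
      (chartAt (EuclideanSpace ℝ (Fin d)) p).source) :
    Real.sqrt (gram q y).det =
      |(fderiv ℝ (transition p q) y).det| * Real.sqrt (gram p (transition p q y)).det := by
  set J : Matrix (Fin d) (Fin d) ℝ := Matrix.of fun k i =>
    (fderiv ℝ (transition p q) y (EuclideanSpace.single i 1)) k with hJ
  have hz : (chartAt (EuclideanSpace ℝ (Fin d)) p).symm (transition p q y) =
      (chartAt (EuclideanSpace ℝ (Fin d)) q).symm y :=
    (chartAt (EuclideanSpace ℝ (Fin d)) p).left_inv hp
  have hg : gram q y = J.transpose * gram p (transition p q y) * J := by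
    ext i j
    rw [gram_apply, modelCoordVector_eq_sum hy hp i, modelCoordVector_eq_sum hy hp j]
    simp only [Matrix.mul_apply, gram_apply, hz, Matrix.transpose_apply, hJ, Matrix.of_apply,
      Finset.sum_mul, Finset.mul_sum, map_sum, map_smul, LinearMap.sum_apply,
      LinearMap.smul_apply, smul_eq_mul]
    refine Finset.sum_congr rfl fun k _ => Finset.sum_congr rfl fun l _ => ?_
    ring
  have hdet : (fderiv ℝ (transition p q) y).det = J.det := by
    rw [ContinuousLinearMap.det,
      ← LinearMap.det_toMatrix (EuclideanSpace.basisFun (Fin d) ℝ).toBasis]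
    congr 1
  rw [hg, Matrix.det_mul, Matrix.det_mul, Matrix.det_transpose, hdet,
    mul_right_comm, Real.sqrt_mul (mul_self_nonneg _), Real.sqrt_mul_self_eq_abs]

theorem aemeasurable_chart_symm [MeasurableSpace M] [BorelSpace M] (p : M)
    (f : EuclideanSpace ℝ (Fin d) → ENNReal) :
    AEMeasurable (chartAt (EuclideanSpace ℝ (Fin d)) p).symm
      (((volume : Measure (EuclideanSpace ℝ (Fin d))).restrict
        (chartAt (EuclideanSpace ℝ (Fin d)) p).target).withDensity f) :=
  AEMeasurable.mono_ac ((chartAt (EuclideanSpace ℝ (Fin d)) p).continuousOn_symm.aemeasurable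
    (chartAt (EuclideanSpace ℝ (Fin d)) p).open_target.measurableSet)
    (withDensity_absolutelyContinuous _ _)

theorem measurableSet_target_inter_preimage [MeasurableSpace M] [BorelSpace M] (p : M) {A : Set M}
    (hA : MeasurableSet A) :
    MeasurableSet ((chartAt (EuclideanSpace ℝ (Fin d)) p).target ∩
      (chartAt (EuclideanSpace ℝ (Fin d)) p).symm ⁻¹' A) := by
  set e := chartAt (EuclideanSpace ℝ (Fin d)) p
  classical
  have := e.continuousOn_symm.measurable_piecewise (f := e.symm) (g := fun _ => p)
    continuousOn_const e.open_target.measurableSet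
  have h2 := e.open_target.measurableSet.inter (this hA)
  convert h2 using 1
  ext y
  by_cases hy : y ∈ e.target <;> simp [hy, Set.piecewise]

theorem chartMeasure_apply [RiemannianBundle (fun x : M ↦ TangentSpace (𝓡 d) x)]
    [MeasurableSpace M] [BorelSpace M] (p : M) {A : Set M} (hA : MeasurableSet A) :
    chartMeasure (d := d) p A = ∫⁻ y in (chartAt (EuclideanSpace ℝ (Fin d)) p).target ∩
      (chartAt (EuclideanSpace ℝ (Fin d)) p).symm ⁻¹' A,
        ENNReal.ofReal (Real.sqrt (gram p y).det) := by
  set e := chartAt (EuclideanSpace ℝ (Fin d)) p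
  have hB := measurableSet_target_inter_preimage (d := d) p hA
  have h0 : MeasurableSet (e.target) := e.open_target.measurableSet
  rw [chartMeasure, Measure.map_apply_of_aemeasurable (aemeasurable_chart_symm p _) hA,
    withDensity_apply', Measure.restrict_restrict₀', inter_comm]
  exact h0.nullMeasurableSet

/-- This is the change of variables formula for the transition map. It is only an inequality because
the chart around `q` may miss part of `A`. -/
theorem chartMeasure_le_of_subset_source [IsManifold (𝓡 d) 1 M]
    [RiemannianBundle (fun x : M ↦ TangentSpace (𝓡 d) x)]
    [MeasurableSpace M] [BorelSpace M] (p q : M) {A : Set M} (hA : MeasurableSet A)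
    (hAp : A ⊆ (chartAt (EuclideanSpace ℝ (Fin d)) p).source) :
    chartMeasure (d := d) q A ≤ chartMeasure (d := d) p A := by
  rw [chartMeasure_apply q hA, chartMeasure_apply p hA]
  set e := chartAt (EuclideanSpace ℝ (Fin d)) p
  set f := chartAt (EuclideanSpace ℝ (Fin d)) q
  have hB : MeasurableSet (f.target ∩ f.symm ⁻¹' A) := measurableSet_target_inter_preimage q hA
  have hinj : InjOn (transition p q) (f.target ∩ f.symm ⁻¹' A) := by
    rintro a ⟨ha, haA⟩ b ⟨hb, hbA⟩ hab
    exact f.symm.injOn ha hb (e.injOn (hAp haA) (hAp hbA) hab)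
  have himg : transition p q '' (f.target ∩ f.symm ⁻¹' A) ⊆ e.target ∩ e.symm ⁻¹' A := by
    rintro _ ⟨y, ⟨hy, hyA⟩, rfl⟩
    refine ⟨e.map_source (hAp hyA), ?_⟩
    change e.symm (e (f.symm y)) ∈ A
    rw [e.left_inv (hAp hyA)]
    exact hyA
  calc ∫⁻ y in f.target ∩ f.symm ⁻¹' A, ENNReal.ofReal (Real.sqrt (gram q y).det)
      = ∫⁻ y in f.target ∩ f.symm ⁻¹' A, ENNReal.ofReal |(fderiv ℝ (transition p q) y).det| *
          ENNReal.ofReal (Real.sqrt (gram p (transition p q y)).det) := by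
        refine setLIntegral_congr_fun hB fun y hy => ?_
        rw [sqrt_det_gram hy.1 (hAp hy.2), ENNReal.ofReal_mul (abs_nonneg _)]
    _ = ∫⁻ y in transition p q '' (f.target ∩ f.symm ⁻¹' A),
          ENNReal.ofReal (Real.sqrt (gram p y).det) := by
        refine (lintegral_image_eq_lintegral_abs_det_fderiv_mul
          (f' := fun y => fderiv ℝ (transition p q) y) volume hB (fun y hy => ?_) hinj
          fun y => ENNReal.ofReal (Real.sqrt (gram p y).det)).symm
        exact ((mdifferentiableAt_transition hy.1 (hAp hy.2)).differentiableAt.hasFDerivAt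
          ).hasFDerivWithinAt
    _ ≤ _ := lintegral_mono_set himg

theorem riemannianMeasure_le_of_subset_source [IsManifold (𝓡 d) 1 M]
    [RiemannianBundle (fun x : M ↦ TangentSpace (𝓡 d) x)]
    [MeasurableSpace M] [BorelSpace M] (p : M) {A : Set M} (hA : MeasurableSet A)
    (hAp : A ⊆ (chartAt (EuclideanSpace ℝ (Fin d)) p).source) :
    riemannianMeasure d M A ≤ chartMeasure (d := d) p A := by
  set S := (chartAt (EuclideanSpace ℝ (Fin d)) p).source
  have hS : MeasurableSet S := (chartAt (EuclideanSpace ℝ (Fin d)) p).open_source.measurableSet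
  -- A supremum of measures is not computed set by set, so it is bounded by one explicit measure
  -- dominating every chart measure: the measure of the chart around `p`, plus a measure that is
  -- infinite on every nonempty set off its domain.
  have hle : riemannianMeasure d M ≤
      chartMeasure (d := d) p + ((⊤ : ENNReal) • Measure.count).restrict Sᶜ := by
    refine iSup_le fun q => Measure.le_iff.2 fun B hB => ?_
    rw [Measure.add_apply, Measure.restrict_apply hB, Measure.smul_apply, ← sdiff_eq]
    rcases (B \ S).eq_empty_or_nonempty with h | h
    · exact (chartMeasure_le_of_subset_source p q hB (sdiff_eq_empty.1 h)).trans le_self_add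
    · rw [smul_eq_mul, ENNReal.top_mul (Measure.count_ne_zero h)]
      simp
  refine (hle A).trans ?_
  rw [Measure.add_apply, Measure.restrict_apply hA, ← sdiff_eq, sdiff_eq_empty.2 hAp]
  simp

/-! ### Local finiteness of the Riemannian measure -/

theorem eventually_norm_coordVector_le [IsManifold (𝓡 d) 1 M]
    [RiemannianBundle (fun x : M ↦ TangentSpace (𝓡 d) x)]
    [IsContinuousRiemannianBundle (EuclideanSpace ℝ (Fin d))
      (fun x : M ↦ TangentSpace (𝓡 d) x)] (p : M) :
    ∃ C > 0, ∀ᶠ y in 𝓝 (chartAt (EuclideanSpace ℝ (Fin d)) p p),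
      ∀ i, ‖coordVector p y i‖ ≤ C := by
  obtain ⟨C, hC, h⟩ := eventually_norm_mfderivWithin_symm_extChartAt_lt (𝓡 d) p
  refine ⟨C, hC, ?_⟩
  simp only [modelWithCornersSelf_coe, range_id, nhdsWithin_univ, mfderivWithin_univ] at h
  filter_upwards [h] with y hy i
  have h1 := ContinuousLinearMap.le_of_opNorm_le (E := EuclideanSpace ℝ (Fin d))
    (F := TangentSpace (𝓡 d) ((extChartAt (𝓡 d) p).symm y))
    (mfderiv (𝓡 d) (𝓡 d) (extChartAt (𝓡 d) p).symm y) hy.le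
    (EuclideanSpace.single i (1 : ℝ))
  have h2 : ‖(EuclideanSpace.single i (1 : ℝ) : EuclideanSpace ℝ (Fin d))‖ = 1 := by simp
  refine (show ‖coordVector p y i‖ ≤ _ from h1).trans (le_of_eq ?_)
  exact (congrArg (C * ·) h2).trans (mul_one C)

theorem eventually_abs_det_gram_le [IsManifold (𝓡 d) 1 M]
    [RiemannianBundle (fun x : M ↦ TangentSpace (𝓡 d) x)]
    [IsContinuousRiemannianBundle (EuclideanSpace ℝ (Fin d))
      (fun x : M ↦ TangentSpace (𝓡 d) x)] (p : M) :
    ∃ C, ∀ᶠ y in 𝓝 (chartAt (EuclideanSpace ℝ (Fin d)) p p), |(gram p y).det| ≤ C := by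
  obtain ⟨C, hC, h⟩ := eventually_norm_coordVector_le (d := d) p
  refine ⟨_, h.mono fun y hy =>
    Matrix.det_le (abv := AbsoluteValue.abs) (x := C * C) fun i j => ?_⟩
  exact (abs_real_inner_le_norm _ _).trans
    (mul_le_mul (hy i) (hy j) (norm_nonneg _) hC.le)

theorem riemannianMeasure_lt_top_of_isCompact [IsManifold (𝓡 d) 1 M]
    [RiemannianBundle (fun x : M ↦ TangentSpace (𝓡 d) x)]
    [IsContinuousRiemannianBundle (EuclideanSpace ℝ (Fin d))
      (fun x : M ↦ TangentSpace (𝓡 d) x)]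
    [MeasurableSpace M] [BorelSpace M] {K : Set M} (hK : IsCompact K) :
    riemannianMeasure d M K < ⊤ := by
  refine hK.measure_lt_top_of_nhdsWithin fun p _ => Measure.FiniteAtFilter.filter_mono
    nhdsWithin_le_nhds ?_
  set e := chartAt (EuclideanSpace ℝ (Fin d)) p with he
  obtain ⟨C, hC⟩ := eventually_abs_det_gram_le (d := d) p
  obtain ⟨r, hr, hball⟩ := Metric.eventually_nhds_iff_ball.1 hC
  have hU : IsOpen (e.source ∩ e ⁻¹' Metric.ball (e p) r) :=
    e.isOpen_inter_preimage Metric.isOpen_ball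
  refine ⟨_, hU.mem_nhds ⟨mem_chart_source _ p, Metric.mem_ball_self hr⟩, ?_⟩
  refine (riemannianMeasure_le_of_subset_source p hU.measurableSet inter_subset_left).trans_lt ?_
  rw [chartMeasure_apply p hU.measurableSet]
  have hsub : e.target ∩ e.symm ⁻¹' (e.source ∩ e ⁻¹' Metric.ball (e p) r) ⊆
      Metric.ball (e p) r := by
    rintro y ⟨hy, -, hy'⟩
    rwa [mem_preimage, e.right_inv hy] at hy'
  calc _ ≤ ∫⁻ y in Metric.ball (e p) r, ENNReal.ofReal (Real.sqrt (gram p y).det) :=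
        lintegral_mono_set hsub
    _ ≤ ∫⁻ _ in Metric.ball (e p) r, ENNReal.ofReal (Real.sqrt C) := by
        refine setLIntegral_mono measurable_const fun y hy => ENNReal.ofReal_le_ofReal
          (Real.sqrt_le_sqrt ((le_abs_self _).trans (hball y hy)))
    _ < ⊤ := by
        rw [setLIntegral_const]
        exact ENNReal.mul_lt_top ENNReal.ofReal_lt_top Metric.isBounded_ball.measure_lt_top

/-! ### Differentials of test functions -/

/-- The differential of a real function, as a one-form. -/
def differential (φ : M → ℝ) (x : M) : TangentSpace (𝓡 d) x →L[ℝ] ℝ :=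
  mfderiv (𝓡 d) 𝓘(ℝ) φ x

theorem differential_eq_zero_of_notMem_tsupport {φ : M → ℝ} {x : M} (hx : x ∉ tsupport φ) :
    differential (d := d) φ x = 0 := by
  have : φ =ᶠ[𝓝 x] fun _ => 0 := notMem_tsupport_iff_eventuallyEq.1 hx
  rw [differential, this.mfderiv_eq]
  exact mfderiv_const

theorem isTestForm_differential [IsManifold (𝓡 d) ∞ M] {φ : M → ℝ} (hφ : ContMDiff (𝓡 d) 𝓘(ℝ) ∞ φ)
    (hc : HasCompactSupport φ) :
    IsTestForm (d := d) (M := M) (differential φ) := by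
  refine ⟨?_, tsupport φ, hc, fun x hx => differential_eq_zero_of_notMem_tsupport hx⟩
  intro x₀
  have h1 := ContMDiffAt.mfderiv_const (n := ∞) (m := ∞) (hφ x₀) (by simp)
  refine (contMDiffAt_hom_bundle (E₂ := Bundle.Trivial M ℝ) _).2 ⟨contMDiffAt_id, ?_⟩
  refine h1.congr_of_eventuallyEq (Eventually.of_forall fun x => ?_)
  ext w
  simp [inTangentCoordinates, ContinuousLinearMap.inCoordinates]
  rfl

/-- Factor `φ` through the chart around `p`: the coordinate expression has continuous derivative,
and the derivative of the chart is locally bounded for the Riemannian norms because the metric is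
continuous. -/
theorem eventually_abs_differential_le [IsManifold (𝓡 d) 1 M]
    [RiemannianBundle (fun x : M ↦ TangentSpace (𝓡 d) x)]
    [IsContinuousRiemannianBundle (EuclideanSpace ℝ (Fin d))
      (fun x : M ↦ TangentSpace (𝓡 d) x)] {φ : M → ℝ} (hφ : ContMDiff (𝓡 d) 𝓘(ℝ) 1 φ) (p : M) :
    ∃ C, ∀ᶠ x in 𝓝 p, ∀ w : TangentSpace (𝓡 d) x,
      |differential φ x w| ≤ C * ‖w‖ := by
  obtain ⟨C, hC, h⟩ := eventually_norm_mfderiv_extChartAt_lt (𝓡 d) p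
  set e := chartAt (EuclideanSpace ℝ (Fin d)) p with he
  have hψ : ContDiffOn ℝ 1 (φ ∘ e.symm) e.target := by
    rw [← contMDiffOn_iff_contDiffOn]
    exact hφ.comp_contMDiffOn (contMDiffOn_chart_symm (n := 1))
  have hcont : ContinuousAt (fun x => ‖fderiv ℝ (φ ∘ e.symm) (e x)‖) p := by
    refine ContinuousAt.norm (ContinuousAt.comp (f := e) ?_
      (e.continuousAt (mem_chart_source _ p)))
    exact (hψ.continuousOn_fderiv_of_isOpen e.open_target le_rfl).continuousAt
      (e.open_target.mem_nhds (mem_chart_target _ p))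
  refine ⟨(‖fderiv ℝ (φ ∘ e.symm) (e p)‖ + 1) * C, ?_⟩
  filter_upwards [h, hcont.eventually_lt_const (lt_add_one _),
    e.open_source.mem_nhds (mem_chart_source _ p)] with x hx hx' hxs w
  have hev : φ =ᶠ[𝓝 x] (φ ∘ e.symm) ∘ e := by
    filter_upwards [e.open_source.mem_nhds hxs] with z hz
    simp [e.left_inv hz]
  have hd : MDifferentiableAt (𝓡 d) 𝓘(ℝ) (φ ∘ e.symm) (e x) :=
    ((hψ.differentiableOn one_ne_zero).differentiableAt
      (e.open_target.mem_nhds (e.map_source hxs))).mdifferentiableAt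
  have h1 : differential φ x w =
      fderiv ℝ (φ ∘ e.symm) (e x) (mfderiv (𝓡 d) (𝓡 d) e x w) := by
    rw [differential, hev.mfderiv_eq,
      mfderiv_comp x hd (mdifferentiableAt_atlas (chart_mem_atlas _ p) hxs),
      mfderiv_eq_fderiv]
    rfl
  rw [h1, mul_assoc]
  refine ((fderiv ℝ (φ ∘ e.symm) (e x)).le_opNorm _).trans ?_
  have h2 := ContinuousLinearMap.le_of_opNorm_le (E := TangentSpace (𝓡 d) x)
    (F := EuclideanSpace ℝ (Fin d)) (mfderiv (𝓡 d) (𝓡 d) (extChartAt (𝓡 d) p) x) hx.le w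
  exact mul_le_mul hx'.le h2 (norm_nonneg _) (by positivity)

theorem exists_abs_differential_le [IsManifold (𝓡 d) 1 M]
    [RiemannianBundle (fun x : M ↦ TangentSpace (𝓡 d) x)]
    [IsContinuousRiemannianBundle (EuclideanSpace ℝ (Fin d))
      (fun x : M ↦ TangentSpace (𝓡 d) x)] {φ : M → ℝ} (hφ : ContMDiff (𝓡 d) 𝓘(ℝ) 1 φ)
    (hc : HasCompactSupport φ) :
    ∃ C, ∀ x, ∀ w : TangentSpace (𝓡 d) x,
      |differential φ x w| ≤ C * ‖w‖ := by
  have key : ∃ C, 0 ≤ C ∧ ∀ x ∈ tsupport φ, ∀ w : TangentSpace (𝓡 d) x,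
      |differential φ x w| ≤ C * ‖w‖ := by
    refine IsCompact.induction_on (p := fun s => ∃ C, 0 ≤ C ∧ ∀ x ∈ s,
      ∀ w : TangentSpace (𝓡 d) x, |differential φ x w| ≤ C * ‖w‖) hc
      ⟨0, le_rfl, by simp⟩ ?_ ?_ ?_
    · rintro s t hst ⟨C, hC, h⟩
      exact ⟨C, hC, fun x hx => h x (hst hx)⟩
    · rintro s t ⟨C, hC, h⟩ ⟨C', hC', h'⟩
      refine ⟨max C C', le_max_of_le_left hC, ?_⟩
      rintro x (hx | hx) w
      · exact (h x hx w).trans (mul_le_mul_of_nonneg_right (le_max_left _ _) (norm_nonneg _))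
      · exact (h' x hx w).trans (mul_le_mul_of_nonneg_right (le_max_right _ _) (norm_nonneg _))
    · intro p _
      obtain ⟨C, hC⟩ := eventually_abs_differential_le (d := d) hφ p
      exact ⟨_, mem_nhdsWithin_of_mem_nhds hC, max C 0, le_max_right _ _, fun x hx w =>
        (hx w).trans (mul_le_mul_of_nonneg_right (le_max_left _ _) (norm_nonneg _))⟩
  obtain ⟨C, hC, h⟩ := key
  refine ⟨C, fun x w => ?_⟩
  by_cases hx : x ∈ tsupport φ
  · exact h x hx w
  · rw [differential_eq_zero_of_notMem_tsupport hx]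
    simpa using mul_nonneg hC (norm_nonneg w)

/-- The tangent map of `φ` is continuous, so `dφ` is a continuous function on the tangent bundle,
and composing it with a Borel section is measurable. -/
theorem measurable_differential_apply [IsManifold (𝓡 d) 1 M] [mM : MeasurableSpace M]
    {φ : M → ℝ} (hφ : ContMDiff (𝓡 d) 𝓘(ℝ) 1 φ) {X : ∀ x : M, TangentSpace (𝓡 d) x}
    (hX : Measurable[mM, borel (TangentBundle (𝓡 d) M)]
      fun y ↦ (⟨y, X y⟩ : TangentBundle (𝓡 d) M)) :
    Measurable fun y ↦ differential φ y (X y) := by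
  have h1 : Continuous fun z : TangentBundle (𝓡 d) M ↦
      differential φ z.1 z.2 := by
    have h2 : Continuous fun z : TangentBundle 𝓘(ℝ) ℝ => (z.2 : ℝ) :=
      continuous_snd.comp (tangentBundleModelSpaceHomeomorph 𝓘(ℝ)).continuous
    exact h2.comp (hφ.continuous_tangentMap le_rfl)
  let _ : MeasurableSpace (TangentBundle (𝓡 d) M) := borel _
  have _ : BorelSpace (TangentBundle (𝓡 d) M) := ⟨rfl⟩
  exact h1.measurable.comp hX

/-! ### Differentiating an expectation under uniform integrability -/

section RealValued

variable {Ω : Type*} [MeasurableSpace Ω] {P : Measure Ω}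

theorem measurable_of_hasDerivWithinAt {u : ℝ → Ω → ℝ} {g : Ω → ℝ} {t : ℝ}
    (hu : ∀ s ∈ Icc (0 : ℝ) 1, Measurable (u s)) (ht : t ∈ Icc (0 : ℝ) 1)
    (hg : ∀ w, HasDerivWithinAt (fun s ↦ u s w) (g w) (Icc 0 1) t) : Measurable g := by
  have : (𝓝[Icc (0 : ℝ) 1 \ {t}] t).NeBot := by
    have h := uniqueDiffWithinAt_iff_accPt.1 (uniqueDiffOn_Icc (zero_lt_one (α := ℝ)) t ht)
    rwa [accPt_principal_iff_nhdsWithin] at h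
  refine measurable_of_tendsto_metrizable' (𝓝[Icc (0 : ℝ) 1 \ {t}] t)
    -- Measurability of `u s` is known only for `s` in `[0,1]`; projecting `s` makes every
    -- difference quotient measurable without changing the limit.
    (f := fun s w ↦ (s - t)⁻¹ * (u (projIcc 0 1 zero_le_one s) w - u t w))
    (fun s ↦ ((hu _ (projIcc 0 1 zero_le_one s).2).sub (hu t ht)).const_mul _) ?_
  refine tendsto_pi_nhds.2 fun w ↦ ?_
  refine (hasDerivWithinAt_iff_tendsto_slope.1 (hg w)).congr' ?_
  filter_upwards [self_mem_nhdsWithin] with s hs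
  rw [slope_def_module, projIcc_of_mem _ hs.1, smul_eq_mul]

theorem unifIntegrable_of_norm_le {ι : Type*} {f g : ι → Ω → ℝ} {C : ℝ}
    (hg : UnifIntegrable g 1 P) (hfg : ∀ i, ∀ᵐ w ∂P, ‖f i w‖ ≤ C * ‖g i w‖) :
    UnifIntegrable f 1 P := by
  intro ε hε
  -- The denominator `|C| + 1` is positive whatever the sign of `C`.
  obtain ⟨δ, hδ, h⟩ := hg (show 0 < ε / (|C| + 1) by positivity)
  refine ⟨δ, hδ, fun i s hs hPs ↦ ?_⟩
  have h1 : eLpNorm (s.indicator (f i)) 1 P ≤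
      ENNReal.ofReal (|C| + 1) * eLpNorm (s.indicator (g i)) 1 P := by
    refine eLpNorm_le_mul_eLpNorm_of_ae_le_mul ?_ 1
    filter_upwards [hfg i] with w hw
    by_cases hws : w ∈ s
    · simp only [indicator_of_mem hws]
      refine hw.trans (mul_le_mul_of_nonneg_right ?_ (norm_nonneg _))
      linarith [le_abs_self C]
    · simp [indicator_of_notMem hws]
  refine h1.trans ((mul_le_mul_right (h i s hs hPs) _).trans_eq ?_)
  rw [← ENNReal.ofReal_mul (by positivity)]
  congr 1
  field_simp

/-- Vitali's theorem: along any sequence of times, pointwise convergence and uniform integrability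
give convergence in `L¹`. -/
theorem continuous_integral_of_unifIntegrable [IsFiniteMeasure P] {G : ℝ → Ω → ℝ}
    (hm : ∀ t, StronglyMeasurable (G t)) (hc : ∀ w, Continuous fun t ↦ G t w)
    (hU : UnifIntegrable G 1 P) (hi : ∀ t, Integrable (G t) P) :
    Continuous fun t ↦ ∫ w, G t w ∂P := by
  refine SeqContinuous.continuous fun s t hs ↦ ?_
  refine tendsto_integral_of_L1' _ (hi t).aestronglyMeasurable
    (Eventually.of_forall fun n ↦ hi (s n)) ?_
  refine tendsto_Lp_finite_of_tendsto_ae le_rfl ENNReal.one_ne_top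
    (fun n ↦ (hm (s n)).aestronglyMeasurable) (memLp_one_iff_integrable.2 (hi t)) ?_
    (Eventually.of_forall fun w ↦ ((hc w).tendsto t).comp hs)
  intro ε hε
  obtain ⟨δ, hδ, h⟩ := hU hε
  exact ⟨δ, hδ, fun n ↦ h (s n)⟩

theorem integrable_prod_of_eLpNorm_le [IsFiniteMeasure P] {G : ℝ → Ω → ℝ}
    (hm : StronglyMeasurable (Function.uncurry G)) {B : NNReal}
    (hB : ∀ t, eLpNorm (G t) 1 P ≤ B) (μ : Measure ℝ) [IsFiniteMeasure μ] :
    Integrable (Function.uncurry G) (μ.prod P) := by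
  refine ⟨hm.aestronglyMeasurable, ?_⟩
  rw [HasFiniteIntegral, lintegral_prod _ hm.enorm.aemeasurable]
  refine (lintegral_mono (g := fun _ ↦ (B : ENNReal)) fun t ↦ ?_).trans_lt ?_
  · simpa [eLpNorm_one_eq_lintegral_enorm] using hB t
  · rw [lintegral_const]
    exact ENNReal.mul_lt_top ENNReal.coe_lt_top (measure_lt_top _ _)

theorem hasDerivWithinAt_integral_of_uniformIntegrable [IsProbabilityMeasure P]
    {u : ℝ → Ω → ℝ} {h : Icc (0 : ℝ) 1 → Ω → ℝ} {C : ℝ}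
    (hm : ∀ t ∈ Icc (0 : ℝ) 1, Measurable (u t))
    (hi : ∀ t ∈ Icc (0 : ℝ) 1, Integrable (u t) P)
    (hu : ∀ᵐ w ∂P, ContDiffOn ℝ 1 (fun t ↦ u t w) (Icc 0 1))
    (hh : UniformIntegrable h 1 P)
    (hle : ∀ t : Icc (0 : ℝ) 1, ∀ᵐ w ∂P,
      ‖derivWithin (fun s ↦ u s w) (Icc 0 1) t‖ ≤ C * ‖h t w‖)
    {t : ℝ} (ht : t ∈ Icc (0 : ℝ) 1) :
    HasDerivWithinAt (fun s ↦ ∫ w, u s w ∂P)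
      (∫ w, derivWithin (fun s ↦ u s w) (Icc 0 1) t ∂P) (Icc 0 1) t := by
  -- The exceptional null set is enlarged to a measurable one, so that cutting off by `A` preserves
  -- measurability and leaves every path regular.
  obtain ⟨A, hA, hAu, hAm⟩ : ∃ A : Set Ω, (∀ᵐ w ∂P, w ∈ A) ∧
      (∀ w ∈ A, ContDiffOn ℝ 1 (fun t ↦ u t w) (Icc 0 1)) ∧ MeasurableSet A := by
    refine ⟨(toMeasurable P {w | ¬ ContDiffOn ℝ 1 (fun t ↦ u t w) (Icc 0 1)})ᶜ, ?_,
      fun w hw ↦ ?_, (measurableSet_toMeasurable _ _).compl⟩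
    · refine mem_ae_iff.2 ?_
      change P (toMeasurable P _)ᶜᶜ = 0
      rw [compl_compl, measure_toMeasurable]
      exact hu
    · by_contra hc
      exact hw (subset_toMeasurable _ _ hc)
  -- Clamping time to `[0,1]` extends the derivative to a process `G` that is continuous on all of
  -- `ℝ`, endpoints included.
  obtain ⟨pr, hpr, hprI, hprc⟩ : ∃ pr : ℝ → ℝ, (∀ t ∈ Icc (0 : ℝ) 1, pr t = t) ∧
      (∀ t, pr t ∈ Icc (0 : ℝ) 1) ∧ Continuous pr :=
    ⟨fun t ↦ projIcc 0 1 zero_le_one t, fun t ht ↦ by simp only [projIcc_of_mem _ ht],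
      fun t ↦ (projIcc 0 1 zero_le_one t).2,
      continuous_subtype_val.comp (continuous_projIcc (h := zero_le_one))⟩
  set G : ℝ → Ω → ℝ := fun t ↦
    A.indicator fun w ↦ derivWithin (fun s ↦ u s w) (Icc 0 1) (pr t) with hG
  have hGA : ∀ t ∈ Icc (0 : ℝ) 1, ∀ w ∈ A,
      G t w = derivWithin (fun s ↦ u s w) (Icc 0 1) t := by
    intro t ht w hw
    simp [hG, indicator_of_mem hw, hpr t ht]
  have hGc : ∀ w, Continuous fun t ↦ G t w := by
    intro w
    by_cases hw : w ∈ A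
    · simp only [hG, indicator_of_mem hw]
      exact ((hAu w hw).continuousOn_derivWithin (uniqueDiffOn_Icc zero_lt_one)
        le_rfl).comp_continuous hprc hprI
    · simp only [hG, indicator_of_notMem hw]
      exact continuous_const
  have hGm : ∀ t, StronglyMeasurable (G t) := by
    intro t
    refine (measurable_of_hasDerivWithinAt (u := fun s ↦ A.indicator (u s))
      (fun s hs ↦ (hm s hs).indicator hAm) (hprI t) fun w ↦ ?_).stronglyMeasurable
    by_cases hw : w ∈ A
    · simp only [hG, indicator_of_mem hw]
      exact (((hAu w hw).differentiableOn one_ne_zero) _ (hprI t)).hasDerivWithinAt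
    · simp only [hG, indicator_of_notMem hw]
      exact hasDerivWithinAt_const _ _ _
  have hGle : ∀ t, ∀ᵐ w ∂P, ‖G t w‖ ≤ C * ‖h ⟨pr t, hprI t⟩ w‖ := by
    intro t
    filter_upwards [hle ⟨pr t, hprI t⟩, hA] with w hw hwA
    simpa only [hG, indicator_of_mem hwA] using hw
  have hGU : UnifIntegrable G 1 P := by
    refine unifIntegrable_of_norm_le (g := fun t ↦ h ⟨pr t, hprI t⟩) (C := C) ?_ hGle
    intro ε hε
    obtain ⟨δ, hδ, h'⟩ := hh.2.1 hε
    exact ⟨δ, hδ, fun t ↦ h' _⟩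
  obtain ⟨B, hB⟩ : ∃ B : NNReal, ∀ t, eLpNorm (G t) 1 P ≤ B := by
    obtain ⟨B, hB⟩ := hh.2.2
    refine ⟨C.toNNReal * B, fun t ↦ ?_⟩
    refine (eLpNorm_le_mul_eLpNorm_of_ae_le_mul (hGle t) 1).trans ?_
    rw [ENNReal.coe_mul]
    exact mul_le_mul' le_rfl (hB _)
  have hGi : ∀ t, Integrable (G t) P := fun t ↦ memLp_one_iff_integrable.1
    ⟨(hGm t).aestronglyMeasurable, (hB t).trans_lt ENNReal.coe_lt_top⟩
  have hGuncurry : StronglyMeasurable (Function.uncurry G) :=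
    stronglyMeasurable_uncurry_of_continuous_of_stronglyMeasurable hGc hGm
  have hcont := continuous_integral_of_unifIntegrable hGm hGc hGU hGi
  have hFTC : ∀ s ∈ Icc (0 : ℝ) 1, ∀ w ∈ A, ∫ r in (0 : ℝ)..s, G r w = u s w - u 0 w := by
    intro s hs w hw
    refine intervalIntegral.integral_eq_sub_of_hasDerivAt_of_le hs.1
      ((hAu w hw).continuousOn.mono (Icc_subset_Icc_right hs.2)) (fun r hr ↦ ?_)
      ((hGc w).intervalIntegrable _ _)
    have hr1 : r ∈ Ioo (0 : ℝ) 1 := ⟨hr.1, hr.2.trans_le hs.2⟩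
    rw [hGA r (Ioo_subset_Icc_self hr1) w hw]
    exact (((hAu w hw).differentiableOn one_ne_zero) r
      (Ioo_subset_Icc_self hr1)).hasDerivWithinAt.hasDerivAt (Icc_mem_nhds hr1.1 hr1.2)
  -- Fubini applied to the fundamental theorem of calculus along each path. The expectation becomes
  -- a primitive of the continuous function `t ↦ E G_t`.
  have hF : ∀ s ∈ Icc (0 : ℝ) 1,
      ∫ w, u s w ∂P = ∫ w, u 0 w ∂P + ∫ r in (0 : ℝ)..s, (∫ w, G r w ∂P) := by
    intro s hs
    have h0 : (0 : ℝ) ∈ Icc (0 : ℝ) 1 := ⟨le_rfl, zero_le_one⟩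
    have h1 : ∫ w, u s w ∂P - ∫ w, u 0 w ∂P = ∫ w, (∫ r in (0 : ℝ)..s, G r w) ∂P := by
      rw [← integral_sub (hi s hs) (hi 0 h0)]
      refine integral_congr_ae ?_
      filter_upwards [hA] with w hw
      exact (hFTC s hs w hw).symm
    have h2 : ∫ r in (0 : ℝ)..s, (∫ w, G r w ∂P) = ∫ w, (∫ r in (0 : ℝ)..s, G r w) ∂P := by
      simp only [intervalIntegral.integral_of_le hs.1]
      exact integral_integral_swap (integrable_prod_of_eLpNorm_le hGuncurry hB _)
    rw [h2, ← h1]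
    ring
  have hval : ∫ w, derivWithin (fun s ↦ u s w) (Icc 0 1) t ∂P = ∫ w, G t w ∂P := by
    refine integral_congr_ae ?_
    filter_upwards [hA] with w hw
    exact (hGA t ht w hw).symm
  rw [hval]
  refine HasDerivWithinAt.congr_of_mem ?_ hF ht
  exact ((hcont.integral_hasStrictDerivAt 0 t).hasDerivAt.const_add _).hasDerivWithinAt

end RealValued

/-! ### Time derivative of the integral against the density -/

theorem TendstoC2.tendstoUniformlyOn {ι : Type*} {F : ι → M → ℝ} {l : Filter ι} {f : M → ℝ}
    (h : TendstoC2 d F l f) {K : Set M} (hK : IsCompact K) : TendstoUniformlyOn F f l K := by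
  rw [← tendstoLocallyUniformlyOn_iff_tendstoUniformlyOn_of_compact hK,
    Metric.tendstoLocallyUniformlyOn_iff]
  intro ε hε p hp
  set e := chartAt (EuclideanSpace ℝ (Fin d)) p
  obtain ⟨V, hV, hV'⟩ := Metric.tendstoLocallyUniformlyOn_iff.1 (h p 0 (Nat.zero_le _)) ε hε (e p)
    (mem_chart_target _ p)
  rw [e.open_target.nhdsWithin_eq (mem_chart_target _ p)] at hV
  refine ⟨e.source ∩ e ⁻¹' V, mem_nhdsWithin_of_mem_nhds (inter_mem
    (e.open_source.mem_nhds (mem_chart_source _ p))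
    ((e.continuousAt (mem_chart_source _ p)).preimage_mem_nhds hV)), ?_⟩
  filter_upwards [hV'] with i hi y hy
  have := hi (e y) hy.2
  rw [iteratedFDeriv_zero_eq_comp, iteratedFDeriv_zero_eq_comp] at this
  simp only [Function.comp_apply, LinearIsometryEquiv.dist_map] at this
  rw [e.left_inv hy.1] at this
  exact this

theorem hasDerivWithinAt_integral_mul [MeasurableSpace M] [BorelSpace M]
    (m : Measure M) [IsFiniteMeasureOnCompacts m] {ρ : ℝ → M → ℝ} (hρ : IsC1C2 d ρ)
    {φ : M → ℝ} (hφ : Continuous φ) (hc : HasCompactSupport φ) {t : ℝ} (ht : t ∈ Icc (0 : ℝ) 1) :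
    HasDerivWithinAt (fun s ↦ ∫ y, ρ s y * φ y ∂m) (∫ y, timeDeriv ρ t y * φ y ∂m)
      (Icc 0 1) t := by
  have hi : ∀ f : M → ℝ, Continuous f → Integrable (fun y ↦ f y * φ y) m := fun f hf ↦
    (hf.mul hφ).integrable_of_hasCompactSupport hc.mul_left
  have hρc : ∀ s ∈ Icc (0 : ℝ) 1, Continuous (ρ s) := fun s hs ↦ (hρ.contMDiff s hs).continuous
  have hdc : Continuous (timeDeriv ρ t) := (hρ.contMDiff_timeDeriv t ht).continuous
  have hunif := (hρ.tendsto_slope t ht).tendstoUniformlyOn (K := tsupport φ) hc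
  rw [hasDerivWithinAt_iff_tendsto_slope]
  have hslope : ∀ᶠ s in 𝓝[Icc (0 : ℝ) 1 \ {t}] t,
      ∫ y, (s - t)⁻¹ * (ρ s y - ρ t y) * φ y ∂m =
        slope (fun s ↦ ∫ y, ρ s y * φ y ∂m) t s := by
    filter_upwards [self_mem_nhdsWithin] with s hs
    rw [slope_def_module, ← integral_sub (hi _ (hρc s hs.1)) (hi _ (hρc t ht)), smul_eq_mul,
      ← integral_const_mul]
    exact integral_congr_ae (Eventually.of_forall fun y ↦ by ring)
  refine Tendsto.congr' hslope ?_
  refine tendsto_integral_filter_of_dominated_convergence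
    -- On the support of `φ` the slopes are eventually within `1` of their uniform limit `∂ₜρ`; off
    -- the support everything vanishes.
    (fun y ↦ (|timeDeriv ρ t y| + 1) * |φ y|) ?_ ?_ ?_ ?_
  · filter_upwards [self_mem_nhdsWithin] with s hs
    exact (hi _ (continuous_const.mul ((hρc s hs.1).sub (hρc t ht)))).aestronglyMeasurable
  · filter_upwards [Metric.tendstoUniformlyOn_iff.1 hunif 1 one_pos] with s hs
    refine Eventually.of_forall fun y ↦ ?_
    rw [norm_mul, Real.norm_eq_abs, Real.norm_eq_abs]
    by_cases hy : y ∈ tsupport φ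
    · refine mul_le_mul_of_nonneg_right ?_ (abs_nonneg _)
      have := hs y hy
      rw [dist_comm, Real.dist_eq] at this
      linarith [abs_sub_abs_le_abs_sub ((s - t)⁻¹ * (ρ s y - ρ t y)) (timeDeriv ρ t y)]
    · simp [image_eq_zero_of_notMem_tsupport hy]
  · exact ((hdc.abs.add continuous_const).mul hφ.abs).integrable_of_hasCompactSupport
      (hc.abs.mul_left)
  · refine Eventually.of_forall fun y ↦ ?_
    by_cases hy : y ∈ tsupport φ
    · exact (hunif.tendsto_at hy).mul_const _
    · simp [image_eq_zero_of_notMem_tsupport hy, tendsto_const_nhds]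

/-! ### Chain rule along paths and the transport equation -/

theorem contDiffOn_comp_path {φ : M → ℝ} (hφ : ContMDiff (𝓡 d) 𝓘(ℝ) 1 φ) {γ : ℝ → M}
    (hγ : ContMDiffOn 𝓘(ℝ) (𝓡 d) 1 γ (Icc 0 1)) :
    ContDiffOn ℝ 1 (fun s ↦ φ (γ s)) (Icc 0 1) := by
  rw [← contMDiffOn_iff_contDiffOn]
  exact hφ.comp_contMDiffOn hγ

theorem derivWithin_comp_path {φ : M → ℝ} (hφ : ContMDiff (𝓡 d) 𝓘(ℝ) 1 φ) {γ : ℝ → M}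
    (hγ : ContMDiffOn 𝓘(ℝ) (𝓡 d) 1 γ (Icc 0 1)) {t : ℝ} (ht : t ∈ Icc (0 : ℝ) 1) :
    derivWithin (fun s ↦ φ (γ s)) (Icc 0 1) t =
      differential φ (γ t) (mfderivWithin 𝓘(ℝ) (𝓡 d) γ (Icc 0 1) t (1 : ℝ)) := by
  have h := mfderiv_comp_mfderivWithin (I := 𝓘(ℝ)) (I' := 𝓡 d) (I'' := 𝓘(ℝ)) (f := γ) (g := φ) t
    (hφ.mdifferentiable one_ne_zero _) (hγ.mdifferentiableOn one_ne_zero t ht)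
    (uniqueDiffOn_Icc zero_lt_one t ht).uniqueMDiffWithinAt
  rw [mfderivWithin_eq_fderivWithin] at h
  rw [← fderivWithin_derivWithin]
  exact DFunLike.congr_fun h (1 : ℝ)

theorem hasDivergence_of_velocityField {d : ℕ}
    {M : Type*} [TopologicalSpace M]
    [ChartedSpace (EuclideanSpace ℝ (Fin d)) M] [IsManifold (𝓡 d) ∞ M]
    [RiemannianBundle (fun x : M ↦ TangentSpace (𝓡 d) x)]
    [IsContinuousRiemannianBundle (EuclideanSpace ℝ (Fin d))
      (fun x : M ↦ TangentSpace (𝓡 d) x)]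
    [MeasurableSpace M] [BorelSpace M]
    {Ω : Type*} [MeasurableSpace Ω] (P : Measure Ω) [IsProbabilityMeasure P]
    (x : ℝ → Ω → M) (hxm : ∀ t ∈ Icc (0 : ℝ) 1, Measurable (x t))
    (hxc : ∀ᵐ w ∂P, ContMDiffOn 𝓘(ℝ) (𝓡 d) 1 (fun t ↦ x t w) (Icc 0 1))
    (hUI : ∀ K : Set M, IsCompact K →
      UniformIntegrable (fun (t : Icc (0 : ℝ) 1) (w : Ω) ↦
        (x t ⁻¹' K).indicator (fun w ↦ ‖pathDeriv (d := d) x t w‖) w) 1 P)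
    (ρ : ℝ → M → ℝ)
    (hρ_nonneg : ∀ t ∈ Icc (0 : ℝ) 1, ∀ y, 0 ≤ ρ t y)
    (hρ : ∀ t ∈ Icc (0 : ℝ) 1,
      P.map (x t) = (riemannianMeasure d M).withDensity fun y ↦ ENNReal.ofReal (ρ t y))
    (hρ_smooth : IsC1C2 d ρ)
    (v : ℝ → ∀ y : M, TangentSpace (𝓡 d) y)
    (hv : IsVelocityField P x v) {t : ℝ} (ht : t ∈ Icc (0 : ℝ) 1) :
    HasDivergence (riemannianMeasure d M) (fun y ↦ ρ t y • v t y)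
      (fun y ↦ - timeDeriv ρ t y) := by
  intro φ hφ hc
  have hφ1 : ContMDiff (𝓡 d) 𝓘(ℝ) 1 φ := hφ.of_le (by simp)
  have hfin : IsFiniteMeasureOnCompacts (riemannianMeasure d M) :=
    ⟨fun _ hK ↦ riemannianMeasure_lt_top_of_isCompact hK⟩
  have hρm : ∀ s ∈ Icc (0 : ℝ) 1, Measurable fun y ↦ ENNReal.ofReal (ρ s y) := fun s hs ↦
    (hρ_smooth.contMDiff s hs).continuous.measurable.ennreal_ofReal
  have hmap : ∀ s ∈ Icc (0 : ℝ) 1, ∀ f : M → ℝ, Measurable f →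
      ∫ w, f (x s w) ∂P = ∫ y, ρ s y * f y ∂(riemannianMeasure d M) := by
    intro s hs f hf
    rw [← integral_map (hxm s hs).aemeasurable hf.aestronglyMeasurable, hρ s hs,
      integral_withDensity_eq_integral_toReal_smul (hρm s hs)
        (Eventually.of_forall fun _ ↦ ENNReal.ofReal_lt_top)]
    exact integral_congr_ae (Eventually.of_forall fun y ↦ by
      simp [ENNReal.toReal_ofReal (hρ_nonneg s hs y)])
  obtain ⟨C, hC⟩ := exists_abs_differential_le (d := d) hφ1 hc
  have hderiv : ∀ s ∈ Icc (0 : ℝ) 1, ∀ᵐ w ∂P, derivWithin (fun s ↦ φ (x s w)) (Icc 0 1) s =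
      differential φ (x s w) (pathDeriv (d := d) x s w) := by
    intro s hs
    filter_upwards [hxc] with w hw
    exact derivWithin_comp_path hφ1 hw hs
  have h1 := hasDerivWithinAt_integral_of_uniformIntegrable (P := P) (u := fun s w ↦ φ (x s w))
    (C := C) (fun s hs ↦ hφ.continuous.measurable.comp (hxm s hs)) (fun s hs ↦ ?_)
    (by filter_upwards [hxc] with w hw using contDiffOn_comp_path hφ1 hw)
    (hUI _ hc) (fun s ↦ ?_) ht
  rotate_left
  · obtain ⟨B, hB⟩ := hc.exists_bound_of_continuous hφ.continuous
    exact Integrable.of_bound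
      (hφ.continuous.measurable.comp (hxm s hs)).aestronglyMeasurable B
      (Eventually.of_forall fun w ↦ hB _)
  -- Here `dφ` vanishes off the support of `φ`, so the bound `C ‖∂ₜx‖` survives the restriction to
  -- `x_t ∈ tsupport φ`, which is the family assumed uniformly integrable.
  · filter_upwards [hderiv s s.2] with w hw
    rw [hw]
    by_cases hK : x s w ∈ tsupport φ
    · rw [indicator_of_mem (show w ∈ x s ⁻¹' tsupport φ from hK), norm_norm]
      exact hC _ _
    · rw [indicator_of_notMem (show w ∉ x s ⁻¹' tsupport φ from hK),
        differential_eq_zero_of_notMem_tsupport hK]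
      simp
  have h2 := hasDerivWithinAt_integral_mul (riemannianMeasure d M) hρ_smooth hφ.continuous hc ht
  -- Derivatives within `[0,1]` are unique, also at the endpoints, so the two computations of the
  -- derivative of `E φ(x_t)` agree.
  have h3 := (uniqueDiffOn_Icc zero_lt_one t ht).eq_deriv _ h1
    (h2.congr_of_mem (fun s hs ↦ hmap s hs φ hφ.continuous.measurable) ht)
  have hcomap : MeasurableSpace.comap (x t) ‹_› ≤ ‹MeasurableSpace Ω› := (hxm t ht).comap_le
  have hcond := hv.condExp t ht _ (isTestForm_differential hφ hc)
  have hvm : Measurable fun y ↦ differential φ y (v t y) :=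
    measurable_differential_apply hφ1 (hv.measurable t ht)
  have h4 : ∫ w, differential φ (x t w) (pathDeriv (d := d) x t w) ∂P =
      ∫ y, ρ t y * differential φ y (v t y) ∂(riemannianMeasure d M) := by
    rw [← hmap t ht _ hvm, ← integral_condExp hcomap]
    exact integral_congr_ae hcond
  have h5 : Integrable (fun y ↦ ρ t y * differential φ y (v t y)) (riemannianMeasure d M) := by
    -- A conditional expectation is always integrable, and `dφ(v(t, x_t))` is a version of one.
    have h6 : Integrable (fun w ↦ differential φ (x t w) (v t (x t w))) P :=
      integrable_condExp.congr hcond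
    have h7 := (integrable_map_measure hvm.aestronglyMeasurable (hxm t ht).aemeasurable).2 h6
    rw [hρ t ht, integrable_withDensity_iff (hρm t ht)
      (Eventually.of_forall fun _ ↦ ENNReal.ofReal_lt_top)] at h7
    refine h7.congr (Eventually.of_forall fun y ↦ ?_)
    simp [ENNReal.toReal_ofReal (hρ_nonneg t ht y), mul_comm]
  have h8 : (fun y ↦ (mfderiv (𝓡 d) 𝓘(ℝ) φ y (ρ t y • v t y) : ℝ)) =
      fun y ↦ ρ t y * differential φ y (v t y) :=
    funext fun y ↦ (differential φ y).map_smul (ρ t y) (v t y)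
  have h9 : Integrable (fun y ↦ timeDeriv ρ t y * φ y) (riemannianMeasure d M) :=
    ((hρ_smooth.contMDiff_timeDeriv t ht).continuous.mul
      hφ.continuous).integrable_of_hasCompactSupport hc.mul_left
  refine ⟨by simp only [neg_mul]; exact h9.neg, by rw [h8]; exact h5, ?_⟩
  rw [h8, ← h4]
  simp only [neg_mul]
  rw [integral_neg, ← h3, integral_congr_ae (hderiv t ht)]

end RiemannianInterpolant

end

theorem theorem1 {d : ℕ}
    {M : Type*} [EMetricSpace M] [CompleteSpace M] [ConnectedSpace M] [SecondCountableTopology M]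
    [ChartedSpace (EuclideanSpace ℝ (Fin d)) M] [IsManifold (𝓡 d) ∞ M]
    [RiemannianBundle (fun x : M ↦ TangentSpace (𝓡 d) x)]
    [IsContMDiffRiemannianBundle (𝓡 d) ∞ (EuclideanSpace ℝ (Fin d))
      (fun x : M ↦ TangentSpace (𝓡 d) x)]
    [IsRiemannianManifold (𝓡 d) M] [MeasurableSpace M] [BorelSpace M]
    {Ω : Type*} [MeasurableSpace Ω] (P : Measure Ω) [IsProbabilityMeasure P]
    (I : ℝ → M → M → M) (x₀ x₁ : Ω → M)
    (hI : RiemannianInterpolant.IsStochasticInterpolant (d := d) P I x₀ x₁)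
    (x : ℝ → Ω → M) (hx : ∀ t w, x t w = I t (x₀ w) (x₁ w))
    (hUI : ∀ K : Set M, IsCompact K →
      UniformIntegrable (fun (t : Icc (0 : ℝ) 1) (w : Ω) ↦
        (x t ⁻¹' K).indicator
          (fun w ↦ ‖RiemannianInterpolant.pathDeriv (d := d) x t w‖) w) 1 P)
    (ρ : ℝ → M → ℝ)
    (hρ_nonneg : ∀ t ∈ Icc (0 : ℝ) 1, ∀ y, 0 ≤ ρ t y)
    (hρ : ∀ t ∈ Icc (0 : ℝ) 1,
      P.map (x t) = (RiemannianInterpolant.riemannianMeasure d M).withDensity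
        fun y ↦ ENNReal.ofReal (ρ t y))
    (hρ_smooth : RiemannianInterpolant.IsC1C2 d ρ)
    (v : ℝ → ∀ y : M, TangentSpace (𝓡 d) y)
    (hv : RiemannianInterpolant.IsVelocityField P x v)
    (hv_int : ∀ t ∈ Icc (0 : ℝ) 1,
      ∫⁻ y, ‖v t y‖ₑ * ENNReal.ofReal (ρ t y) ∂(RiemannianInterpolant.riemannianMeasure d M) < ⊤) :
    ∃ divρv : ℝ → M → ℝ, ∀ t ∈ Icc (0 : ℝ) 1,
      RiemannianInterpolant.HasDivergence (RiemannianInterpolant.riemannianMeasure d M)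
        (fun y ↦ ρ t y • v t y) (divρv t) ∧
      ∀ y, RiemannianInterpolant.timeDeriv ρ t y + divρv t y = 0 := by
  have hcont : IsContinuousRiemannianBundle (EuclideanSpace ℝ (Fin d))
      (fun x : M ↦ TangentSpace (𝓡 d) x) := by
    obtain ⟨g, hg, hinner⟩ := IsContMDiffRiemannianBundle.exists_contMDiff (IB := 𝓡 d) (n := ∞)
      (F := EuclideanSpace ℝ (Fin d)) (E := fun x : M ↦ TangentSpace (𝓡 d) x)
    exact ⟨g, hg.continuous, hinner⟩
  have hxm : ∀ t ∈ Icc (0 : ℝ) 1, Measurable (x t) := by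
    intro t ht
    rw [show x t = fun w ↦ I t (x₀ w) (x₁ w) from funext (hx t)]
    exact (hI.measurable t ht).comp (hI.measurable_left.prodMk hI.measurable_right)
  have hxc : ∀ᵐ w ∂P, ContMDiffOn 𝓘(ℝ) (𝓡 d) 1 (fun t ↦ x t w) (Icc 0 1) := by
    simpa only [hx] using hI.contMDiffOn
  exact ⟨fun t y ↦ - RiemannianInterpolant.timeDeriv ρ t y, fun t ht ↦
    ⟨RiemannianInterpolant.hasDivergence_of_velocityField P x hxm hxc hUI ρ hρ_nonneg hρ
      hρ_smooth v hv ht,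
      fun y ↦ add_neg_cancel _⟩⟩
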